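/- Conventions. For $n\ge 1$ let $\mathcal{NCP}(n)$ be the set of noncrossing partitions of $[n-1]=\{1,\dots,n-1\}$ (partitions with no two distinct blocks $\pi,\pi'$ and $a,b\in\pi$, $c,d\in\pi'$ such that $a<c<b<d$), and let $\mathcal{NCP}(0)=\emptyset$. For $P\in\mathcal{NCP}(m)$, $Q\in\mathcal{NCP}(n)$ and $1\le i\le m$ let $P\diamond_i Q\in\mathcal{NCP}(m+n-1)$ be the partition obtained by inserting $Q$ into the $i$-th gap of $P$: its blocks are the sets $\chi(\pi)$, $\pi\in P$, and $\rho+i-1$, $\rho\in Q$, where $\chi(p)=p$ if $p<i$ and $\chi(p)=p+n-1$ otherwise. With the empty partition in $\mathcal{NCP}(1)$ as unit $I$, these partial compositions make $\mathcal{NCP}$ a non-symmetric set operad, the noncrossing gap-insertion operad. Proposition. For $n\ge 2$ let $p_n=\{[n-1]\}\in\mathcal{NCP}(n)$ be the partition with one block. Then the operad $\mathcal{NCP}$ is generated by the elements $p_n$, $n\ge 2$, subject only to the relations $$p_m\diamond_m p_n=p_n\diamond_1 p_m\qquad (m,n\ge 2).$$ That is: these relations hold in $\mathcal{NCP}$,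 every element of $\mathcal{NCP}$ is obtained from $I$ and the $p_n$ by partial compositions, and if $\mathcal Q$ denotes the non-symmetric set operad presented by generators $q_n$ of arity $n$, one for each $n\ge2$, and the relations $q_m\circ_m q_n=q_n\circ_1 q_m$ for $m,n\ge2$, then there is an isomorphism of operads $\mathcal Q\to\mathcal{NCP}$ that sends $q_n$ to $p_n$ for all $n\ge2$. Consequently, let $\mathbb K$ be a field. An $\mathcal{NCP}$-algebra structure on a $\mathbb K$-vector space $V$ is a morphism of linear operads from the operad of spans $\mathbb K\,\mathcal{NCP}(n)$ to the endomorphism operad of $V$. Sending such a structure to the family of $n$-multilinear maps $\langle -,\dots,-\rangle\colon V^n\to V$, $n\ge2$, by which the $p_n$ act, is a bijection from the $\mathcal{NCP}$-algebra structures on $V$ onto the families of multilinear maps (one of each arity $n\ge2$) that satisfy, for all $m,n\ge2$ and $x_1,\dots,x_{m+n-1}\in V$, $$\langle x_1,\dots,x_{m-1},\langle x_m,\dots,x_{m+n-1}\rangle\rangle=\langle\langle x_1,\dots,x_m\rangle,x_{m+1},\dots,x_{m+n-1}\rangle .$$ Moreover, a linear map between $\mathcal{NCP}$-algebras is a morphism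 of $\mathcal{NCP}$-algebras if and only if it commutes with these operations for all $n\ge2$. -/

import Mathlib

/-! ### Non-symmetric set operads -/

/-- A non-symmetric, single-coloured set operad, in the partial composition presentation.
`comp i hi hk p q` is the composite `p ∘ q` of `p` (arity `m`) with `q` (arity `n`) put into the
input slot `i` of `p`; its arity is `k = m + n - 1`, recorded by `hk : k + 1 = m + n`.
Input slots are numbered from `0`, so slot `i` here is the slot usually called `i + 1`. -/
structure NSOperad where
  Op : ℕ → Type*
  unit : Op 1
  comp : ∀ {m n k : ℕ} (i : ℕ), i < m → k + 1 = m + n → Op m → Op n → Op k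
  unit_comp : ∀ {n : ℕ} (hi : 0 < 1) (hk : n + 1 = 1 + n) (q : Op n), comp 0 hi hk unit q = q
  comp_unit : ∀ {m : ℕ} (i : ℕ) (hi : i < m) (hk : m + 1 = m + 1) (p : Op m),
    comp i hi hk p unit = p
  /-- Sequential (nested) composition. -/
  comp_seq : ∀ {m n l s t k : ℕ} (i j : ℕ) (hi : i < m) (hj : j < n) (hs : s + 1 = m + n)
    (ht : t + 1 = n + l) (hij : i + j < s) (hk : k + 1 = s + l) (hk' : k + 1 = m + t)
    (p : Op m) (q : Op n) (r : Op l),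
    comp (i + j) hij hk (comp i hi hs p q) r = comp i hi hk' p (comp j hj ht q r)
  /-- Parallel composition in two slots `i < j + 1` of `p`. -/
  comp_par : ∀ {m n l s t k : ℕ} (i j : ℕ) (_ : i ≤ j) (hi : i < m) (hj : j + 1 < m)
    (hs : s + 1 = m + n) (ht : t + 1 = m + l) (hj' : j + n < s) (hi' : i < t)
    (hk : k + 1 = s + l) (hk' : k + 1 = t + n) (p : Op m) (q : Op n) (r : Op l),
    comp (j + n) hj' hk (comp i hi hs p q) r = comp i hi' hk' (comp (j + 1) hj ht p r) q

namespace NSOperad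

/-- Morphisms of non-symmetric set operads. -/
structure Hom (O P : NSOperad) where
  map : ∀ n : ℕ, O.Op n → P.Op n
  map_unit : map 1 O.unit = P.unit
  map_comp : ∀ {m n k : ℕ} (i : ℕ) (hi : i < m) (hk : k + 1 = m + n) (p : O.Op m) (q : O.Op n),
    map k (O.comp i hi hk p q) = P.comp i hi hk (map m p) (map n q)

/-- The suboperad of `O` generated by a family `G` of operations: the smallest family of
operations that contains `G` and the unit and is closed under composition. -/
inductive Generated (O : NSOperad) (G : ∀ n : ℕ, O.Op n → Prop) : ∀ n : ℕ, O.Op n → Prop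
  | unit : Generated O G 1 O.unit
  | gen {n : ℕ} (x : O.Op n) : G n x → Generated O G n x
  | comp {m n k : ℕ} (i : ℕ) (hi : i < m) (hk : k + 1 = m + n) (p : O.Op m) (q : O.Op n) :
      Generated O G m p → Generated O G n q → Generated O G k (O.comp i hi hk p q)

/-! ### The operad presented by generators and relations -/

/-- Formal operadic expressions in generators `S n` of arity `n`. -/
inductive Term (S : ℕ → Type*) : ℕ → Type _
  | unit : Term S 1
  | gen {n : ℕ} (s : S n) : Term S n
  | comp {m n k : ℕ} (i : ℕ) (hi : i < m) (hk : k + 1 = m + n) (p : Term S m) (q : Term S n) :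
      Term S k

/-- The smallest equivalence relation on formal expressions that contains `R`, is compatible with
composition, and makes the operad axioms hold. -/
inductive TermEq (S : ℕ → Type*) (R : ∀ n : ℕ, Term S n → Term S n → Prop) :
    ∀ n : ℕ, Term S n → Term S n → Prop
  | rel {n : ℕ} (p q : Term S n) : R n p q → TermEq S R n p q
  | refl {n : ℕ} (p : Term S n) : TermEq S R n p p
  | symm {n : ℕ} (p q : Term S n) : TermEq S R n p q → TermEq S R n q p
  | trans {n : ℕ} (p q r : Term S n) : TermEq S R n p q → TermEq S R n q r → TermEq S R n p r
  | comp {m n k : ℕ} (i : ℕ) (hi : i < m) (hk : k + 1 = m + n) (p p' : Term S m)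
      (q q' : Term S n) : TermEq S R m p p' → TermEq S R n q q' →
      TermEq S R k (Term.comp i hi hk p q) (Term.comp i hi hk p' q')
  | unit_comp {n : ℕ} (hi : 0 < 1) (hk : n + 1 = 1 + n) (q : Term S n) :
      TermEq S R n (Term.comp 0 hi hk Term.unit q) q
  | comp_unit {m : ℕ} (i : ℕ) (hi : i < m) (hk : m + 1 = m + 1) (p : Term S m) :
      TermEq S R m (Term.comp i hi hk p Term.unit) p
  | comp_seq {m n l s t k : ℕ} (i j : ℕ) (hi : i < m) (hj : j < n) (hs : s + 1 = m + n)
      (ht : t + 1 = n + l) (hij : i + j < s) (hk : k + 1 = s + l) (hk' : k + 1 = m + t)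
      (p : Term S m) (q : Term S n) (r : Term S l) :
      TermEq S R k (Term.comp (i + j) hij hk (Term.comp i hi hs p q) r)
        (Term.comp i hi hk' p (Term.comp j hj ht q r))
  | comp_par {m n l s t k : ℕ} (i j : ℕ) (hle : i ≤ j) (hi : i < m) (hj : j + 1 < m)
      (hs : s + 1 = m + n) (ht : t + 1 = m + l) (hj' : j + n < s) (hi' : i < t)
      (hk : k + 1 = s + l) (hk' : k + 1 = t + n) (p : Term S m) (q : Term S n) (r : Term S l) :
      TermEq S R k (Term.comp (j + n) hj' hk (Term.comp i hi hs p q) r)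
        (Term.comp i hi' hk' (Term.comp (j + 1) hj ht p r) q)

/-- The non-symmetric set operad with generators `S` and relations `R`. -/
def presented (S : ℕ → Type*) (R : ∀ n : ℕ, Term S n → Term S n → Prop) : NSOperad where
  Op n := Quot (TermEq S R n)
  unit := Quot.mk _ Term.unit
  comp {m n k} i hi hk p q := Quot.map₂ (Term.comp i hi hk)
    (fun _ _ _ h => TermEq.comp i hi hk _ _ _ _ (TermEq.refl _) h)
    (fun _ _ _ h => TermEq.comp i hi hk _ _ _ _ h (TermEq.refl _)) p q
  unit_comp hi hk q := by
    induction q using Quot.ind with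
    | mk q => exact Quot.sound (TermEq.unit_comp hi hk q)
  comp_unit i hi hk p := by
    induction p using Quot.ind with
    | mk p => exact Quot.sound (TermEq.comp_unit i hi hk p)
  comp_seq i j hi hj hs ht hij hk hk' p q r := by
    induction p using Quot.ind with
    | mk p =>
      induction q using Quot.ind with
      | mk q =>
        induction r using Quot.ind with
        | mk r => exact Quot.sound (TermEq.comp_seq i j hi hj hs ht hij hk hk' p q r)
  comp_par i j hle hi hj hs ht hj' hi' hk hk' p q r := by
    induction p using Quot.ind with
    | mk p =>
      induction q using Quot.ind with
      | mk q =>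
        induction r using Quot.ind with
        | mk r => exact Quot.sound (TermEq.comp_par i j hle hi hj hs ht hj' hi' hk hk' p q r)

/-- The operation of the presented operad given by a generator. -/
def presented.of {S : ℕ → Type*} {R : ∀ n : ℕ, Term S n → Term S n → Prop} {n : ℕ} (s : S n) :
    (presented S R).Op n :=
  Quot.mk _ (Term.gen s)

/-! ### Algebras over a set operad, in vector spaces -/

/-- The bilinear extension of the composition in slot `i` to the vector spaces spanned by the
operations of a set operad. -/
noncomputable def linComp (K : Type*) [Field K] (O : NSOperad) {m n k : ℕ} (i : ℕ) (hi : i < m)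
    (hk : k + 1 = m + n) (a : O.Op m →₀ K) (b : O.Op n →₀ K) : O.Op k →₀ K :=
  a.sum fun p x => b.sum fun q y => Finsupp.single (O.comp i hi hk p q) (x * y)

end NSOperad

/-- Composition in the endomorphism operad of `V`:
`(f ∘ g)(v₀, …, v_{k-1}) = f(v₀, …, v_{i-1}, g(v_i, …, v_{i+n-1}), v_{i+n}, …, v_{k-1})`. -/
def endComp {V : Type*} {m n k : ℕ} (i : ℕ) (hi : i < m) (hk : k + 1 = m + n)
    (f : (Fin m → V) → V) (g : (Fin n → V) → V) (v : Fin k → V) : V :=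
  f fun j : Fin m =>
    if h₁ : j.val < i then v ⟨j.val, by omega⟩
    else if h₂ : j.val = i then g fun l : Fin n => v ⟨i + l.val, by omega⟩
    else v ⟨j.val + n - 1, by omega⟩

/-- The structure on the vector space `V` of an algebra over the linear operad spanned by the set
operad `O`: a morphism of linear operads from it to the endomorphism operad of `V`. -/
structure NSOperad.AlgebraOn (O : NSOperad) (K : Type*) [Field K] (V : Type*) [AddCommGroup V]
    [Module K V] where
  act : ∀ n : ℕ, (O.Op n →₀ K) →ₗ[K] MultilinearMap K (fun _ : Fin n => V) V
  act_unit : ∀ v : Fin 1 → V, act 1 (Finsupp.single O.unit 1) v = v 0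
  act_comp : ∀ {m n k : ℕ} (i : ℕ) (hi : i < m) (hk : k + 1 = m + n) (a : O.Op m →₀ K)
    (b : O.Op n →₀ K) (v : Fin k → V),
    act k (O.linComp K i hi hk a b) v = endComp i hi hk (act m a) (act n b) v

/-- A linear map is a morphism of algebras over `O`. -/
def NSOperad.AlgebraOn.IsHom {O : NSOperad} {K : Type*} [Field K] {V W : Type*} [AddCommGroup V]
    [Module K V] [AddCommGroup W] [Module K W] (A : O.AlgebraOn K V) (B : O.AlgebraOn K W)
    (f : V →ₗ[K] W) : Prop :=
  ∀ (n : ℕ) (a : O.Op n →₀ K) (v : Fin n → V), f (A.act n a v) = B.act n a (fun j => f (v j))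

/-! ### Noncrossing partitions and gap insertion -/

/-- A partition is noncrossing when there are no two distinct blocks `A`, `B` with `a, b ∈ A`,
`c, d ∈ B` and `a < c < b < d`. -/
def IsNoncrossing {s : Finset ℕ} (P : Finpartition s) : Prop :=
  ∀ A ∈ P.parts, ∀ B ∈ P.parts, A ≠ B →
    ¬ ∃ a ∈ A, ∃ b ∈ A, ∃ c ∈ B, ∃ d ∈ B, a < c ∧ c < b ∧ b < d

/-- The relabelling of the elements of a partition when a partition of degree `b` is inserted into
its gap number `i`, that is, immediately before its element `i` (elements are numbered from `0`). -/
def gapShift (i b : ℕ) (p : ℕ) : ℕ := if p < i then p else p + b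

theorem gapShift_strictMono (i b : ℕ) : StrictMono (gapShift i b) := by
  intro p q h
  unfold gapShift
  split_ifs <;> omega

/-- The blocks of the partition obtained by inserting `Q` (of degree `b`) into the gap `i` of `P`. -/
def gapParts (i b : ℕ) (P Q : Finset (Finset ℕ)) : Finset (Finset ℕ) :=
  P.image (fun A => A.image (gapShift i b)) ∪ Q.image (fun B => B.image (fun x => x + i))

/-- Insertion of a partition of a `b`-element set into the gap `i` of a partition of an
`a`-element set. -/
def gapInsert {a b c : ℕ} (i : ℕ) (hi : i ≤ a) (hc : c = a + b) (P : Finpartition (Finset.range a))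
    (Q : Finpartition (Finset.range b)) : Finpartition (Finset.range c) :=
  Finpartition.ofExistsUnique (gapParts i b P.parts Q.parts)
    (by
      intro T hT x hx
      simp only [gapParts, Finset.mem_union, Finset.mem_image] at hT
      rw [Finset.mem_range]
      rcases hT with ⟨A, hA, rfl⟩ | ⟨B, hB, rfl⟩
      · obtain ⟨y, hy, rfl⟩ := Finset.mem_image.1 hx
        have := Finset.mem_range.1 (P.le hA hy)
        unfold gapShift
        split_ifs <;> omega
      · obtain ⟨y, hy, rfl⟩ := Finset.mem_image.1 hx
        have := Finset.mem_range.1 (Q.le hB hy)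
        omega)
    (by
      intro x hx
      rw [Finset.mem_range] at hx
      by_cases hQ : i ≤ x ∧ x < i + b
      · obtain ⟨B, ⟨hB, hxB⟩, huB⟩ :=
          Q.existsUnique_mem (a := x - i) (Finset.mem_range.2 (by omega))
        refine ⟨B.image (fun x => x + i), ⟨?_, ?_⟩, ?_⟩
        · exact Finset.mem_union_right _ (Finset.mem_image_of_mem _ hB)
        · exact Finset.mem_image.2 ⟨x - i, hxB, by omega⟩
        · rintro T ⟨hT, hxT⟩
          simp only [gapParts, Finset.mem_union, Finset.mem_image] at hT
          rcases hT with ⟨A, hA, rfl⟩ | ⟨B', hB', rfl⟩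
          · obtain ⟨y, -, rfl⟩ := Finset.mem_image.1 hxT
            exfalso
            unfold gapShift at hQ
            split_ifs at hQ <;> omega
          · obtain ⟨y, hy, rfl⟩ := Finset.mem_image.1 hxT
            rw [huB B' ⟨hB', by simpa using hy⟩]
      · obtain ⟨y, hya, rfl⟩ : ∃ y, y < a ∧ gapShift i b y = x := by
          by_cases h : x < i
          · exact ⟨x, by omega, by simp [gapShift, h]⟩
          · exact ⟨x - b, by omega, by unfold gapShift; split_ifs <;> omega⟩
        obtain ⟨A, ⟨hA, hyA⟩, huA⟩ := P.existsUnique_mem (Finset.mem_range.2 hya)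
        refine ⟨A.image (gapShift i b), ⟨?_, ?_⟩, ?_⟩
        · exact Finset.mem_union_left _
            (Finset.mem_image_of_mem (fun A => A.image (gapShift i b)) hA)
        · exact Finset.mem_image_of_mem _ hyA
        · rintro T ⟨hT, hxT⟩
          simp only [gapParts, Finset.mem_union, Finset.mem_image] at hT
          rcases hT with ⟨A', hA', rfl⟩ | ⟨B', hB', rfl⟩
          · obtain ⟨z, hz, hzy⟩ := Finset.mem_image.1 hxT
            rw [(gapShift_strictMono i b).injective hzy] at hz
            rw [huA A' ⟨hA', hz⟩]
          · obtain ⟨z, hz, hzy⟩ := Finset.mem_image.1 hxT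
            have := Finset.mem_range.1 (Q.le hB' hz)
            exfalso
            omega)
    (by
      simp only [gapParts, Finset.mem_union, Finset.mem_image, Finset.image_eq_empty, not_or,
        not_exists, not_and]
      exact ⟨fun A hA h => P.ne_bot hA h, fun B hB h => Q.ne_bot hB h⟩)

theorem gapInsert_isNoncrossing {a b c : ℕ} (i : ℕ) (hi : i ≤ a) (hc : c = a + b)
    {P : Finpartition (Finset.range a)} {Q : Finpartition (Finset.range b)}
    (hP : IsNoncrossing P) (hQ : IsNoncrossing Q) : IsNoncrossing (gapInsert i hi hc P Q) := by
  have hg : ∀ p, gapShift i b p < i ∨ i + b ≤ gapShift i b p := by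
    intro p
    unfold gapShift
    split_ifs <;> omega
  intro A hA B hB hAB
  change A ∈ gapParts i b P.parts Q.parts at hA
  change B ∈ gapParts i b P.parts Q.parts at hB
  simp only [gapParts, Finset.mem_union, Finset.mem_image] at hA hB
  rintro ⟨w, hw, x, hx, y, hy, z, hz, h₁, h₂, h₃⟩
  rcases hA with ⟨A, hA, rfl⟩ | ⟨A, hA, rfl⟩ <;> rcases hB with ⟨B, hB, rfl⟩ | ⟨B, hB, rfl⟩ <;>
    obtain ⟨w, hw', rfl⟩ := Finset.mem_image.1 hw <;>
    obtain ⟨x, hx', rfl⟩ := Finset.mem_image.1 hx <;>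
    obtain ⟨y, hy', rfl⟩ := Finset.mem_image.1 hy <;>
    obtain ⟨z, hz', rfl⟩ := Finset.mem_image.1 hz
  · rw [(gapShift_strictMono i b).lt_iff_lt] at h₁ h₂ h₃
    exact hP A hA B hB (fun h => hAB (by rw [h])) ⟨w, hw', x, hx', y, hy', z, hz', h₁, h₂, h₃⟩
  · have := Finset.mem_range.1 (Q.le hB hy')
    have := Finset.mem_range.1 (Q.le hB hz')
    have := hg x
    omega
  · have := Finset.mem_range.1 (Q.le hA hw')
    have := Finset.mem_range.1 (Q.le hA hx')
    have := hg y
    omega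
  · exact hQ A hA B hB (fun h => hAB (by rw [h]))
      ⟨w, hw', x, hx', y, hy', z, hz', by omega, by omega, by omega⟩

/-- The operations of arity `n` of the noncrossing gap-insertion operad: the noncrossing
partitions of a linearly ordered set with `n - 1` elements; there are none for `n = 0`. -/
@[ext]
structure GapNCP (n : ℕ) where
  arity_pos : 1 ≤ n
  part : Finpartition (Finset.range (n - 1))
  noncrossing : IsNoncrossing part

theorem GapNCP.ext_parts {n : ℕ} {x y : GapNCP n} (h : x.part.parts = y.part.parts) : x = y :=
  GapNCP.ext (Finpartition.ext h)

/-- The empty partition, of arity `1`. -/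
def GapNCP.empty : GapNCP 1 where
  arity_pos := le_refl 1
  part := Finpartition.empty (Finset ℕ)
  noncrossing := by
    intro A hA
    exact absurd hA (Finset.notMem_empty A)

/-- The one-block partition of a set with `n - 1` elements, an operation of arity `n ≥ 2`. -/
def GapNCP.oneBlock (n : ℕ) (hn : 2 ≤ n) : GapNCP n where
  arity_pos := by omega
  part := Finpartition.indiscrete (a := Finset.range (n - 1))
    (by rw [Finset.bot_eq_empty, Ne, Finset.range_eq_empty_iff]; omega)
  noncrossing := by
    intro A hA B hB hAB
    rw [Finpartition.indiscrete_parts, Finset.mem_singleton] at hA hB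
    exact absurd (hA.trans hB.symm) hAB

/-- The noncrossing gap-insertion operad. -/
def gapNCP : NSOperad where
  Op := GapNCP
  unit := GapNCP.empty
  comp {m n k} i hi hk p q :=
    { arity_pos := by
        have := p.arity_pos
        have := q.arity_pos
        omega
      part := gapInsert i (by omega)
        (by have := p.arity_pos; have := q.arity_pos; omega) p.part q.part
      noncrossing := gapInsert_isNoncrossing i _ _ p.noncrossing q.noncrossing }
  unit_comp {n} hi hk q := by
    apply GapNCP.ext_parts
    change gapParts 0 (n - 1) ∅ q.part.parts = q.part.parts
    simp [gapParts]
  comp_unit {m} i hi hk p := by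
    apply GapNCP.ext_parts
    change gapParts i 0 p.part.parts ∅ = p.part.parts
    have : gapShift i 0 = id := by
      funext x
      simp [gapShift]
    simp [gapParts, this]
  comp_seq {m n l s t k} i j hi hj hs ht hij hk hk' p q r := by
    have := p.arity_pos
    have := q.arity_pos
    have := r.arity_pos
    apply GapNCP.ext_parts
    change gapParts (i + j) (l - 1) (gapParts i (n - 1) p.part.parts q.part.parts) r.part.parts =
      gapParts i (t - 1) p.part.parts (gapParts j (l - 1) q.part.parts r.part.parts)
    have e₁ : gapShift (i + j) (l - 1) ∘ gapShift i (n - 1) = gapShift i (t - 1) := by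
      funext x
      simp only [gapShift, Function.comp]
      split_ifs <;> omega
    have e₂ : (gapShift (i + j) (l - 1) ∘ fun x => x + i) =
        (fun x => x + i) ∘ gapShift j (l - 1) := by
      funext x
      simp only [gapShift, Function.comp]
      split_ifs <;> omega
    have e₃ : (fun x => x + (i + j)) = (fun x => x + i) ∘ (fun x => x + j) := by
      funext x
      simp only [Function.comp]
      omega
    simp only [gapParts, Finset.image_union, Finset.image_image, Function.comp_def] at *
    simp only [e₁, e₂, e₃, Finset.union_assoc]
  comp_par {m n l s t k} i j hle hi hj hs ht hj' hi' hk hk' p q r := by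
    have := p.arity_pos
    have := q.arity_pos
    have := r.arity_pos
    apply GapNCP.ext_parts
    change gapParts (j + n) (l - 1) (gapParts i (n - 1) p.part.parts q.part.parts) r.part.parts =
      gapParts i (n - 1) (gapParts (j + 1) (l - 1) p.part.parts r.part.parts) q.part.parts
    have e₁ : gapShift (j + n) (l - 1) ∘ gapShift i (n - 1) =
        gapShift i (n - 1) ∘ gapShift (j + 1) (l - 1) := by
      funext x
      simp only [gapShift, Function.comp]
      split_ifs <;> omega
    have e₂ : q.part.parts.image
          (fun B => B.image (gapShift (j + n) (l - 1) ∘ fun x => x + i)) =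
        q.part.parts.image (fun B => B.image (fun x => x + i)) := by
      refine Finset.image_congr fun B hB => Finset.image_congr fun x hx => ?_
      have := Finset.mem_range.1 (q.part.le hB hx)
      simp only [gapShift, Function.comp]
      split_ifs <;> omega
    have e₃ : gapShift i (n - 1) ∘ (fun x => x + (j + 1)) = (fun x => x + (j + n)) := by
      funext x
      simp only [gapShift, Function.comp]
      split_ifs <;> omega
    simp only [gapParts, Finset.image_union, Finset.image_image, Function.comp_def] at *
    simp only [e₁, e₂, e₃]
    rw [Finset.union_right_comm]

/-- The one-block partition `pₙ` as an operation of arity `n ≥ 2` of the operad `gapNCP`. -/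
def gapNCP.p (n : ℕ) (hn : 2 ≤ n) : gapNCP.Op n := GapNCP.oneBlock n hn

/-- One formal generator of each arity `n ≥ 2`. -/
def GapGen (n : ℕ) : Type := PLift (2 ≤ n)

/-- The relations `pₘ ∘ₘ pₙ = pₙ ∘₁ pₘ` for `m, n ≥ 2` between the formal generators
(slots are numbered from `0`). -/
inductive GapRel : ∀ k : ℕ, NSOperad.Term GapGen k → NSOperad.Term GapGen k → Prop
  | mk {m n k : ℕ} (hm : 2 ≤ m) (hn : 2 ≤ n) (hk : k + 1 = m + n) :
      GapRel k
        (NSOperad.Term.comp (m - 1) (by omega) hk (NSOperad.Term.gen (S := GapGen) (PLift.up hm))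
          (NSOperad.Term.gen (S := GapGen) (PLift.up hn)))
        (NSOperad.Term.comp 0 (by omega) (hk.trans (Nat.add_comm m n))
          (NSOperad.Term.gen (S := GapGen) (PLift.up hn))
          (NSOperad.Term.gen (S := GapGen) (PLift.up hm)))

/-- The identity, for all `m, n ≥ 2`,
`⟨x₁, …, x_{m-1}, ⟨x_m, …, x_{m+n-1}⟩⟩ = ⟨⟨x₁, …, x_m⟩, x_{m+1}, …, x_{m+n-1}⟩`
for a family of operations `⟨-, …, -⟩` on `V`, one of each arity at least `2`
(the variables are numbered from `0` in the code). -/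
def BracketIdentity {V : Type*} (br : ∀ n : ℕ, 2 ≤ n → (Fin n → V) → V) : Prop :=
  ∀ (m n : ℕ) (hm : 2 ≤ m) (hn : 2 ≤ n) (x : Fin (m + n - 1) → V),
    br m hm (fun j : Fin m =>
        if _h : j.val < m - 1 then x ⟨j.val, by omega⟩
        else br n hn fun l : Fin n => x ⟨m - 1 + l.val, by omega⟩) =
      br n hn (fun j : Fin n =>
        if _h : j.val = 0 then br m hm fun l : Fin m => x ⟨l.val, by omega⟩
        else x ⟨m - 1 + j.val, by omega⟩)

/-! A noncrossing partition of a nonempty set has a block that is an interval: a block of least span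
`max - min` works, because any block meeting a hole of it would be trapped inside that hole and have
smaller span. Removing an interval block writes the partition as `x ∘ᵢ pₙ` with `x` of smaller arity
(`exists_eq_comp_p`), so the `pₙ` generate by induction. In the relation `pₘ ∘ pₙ = pₙ ∘ pₘ` both
sides consist of an initial interval of `m - 1` points followed by one of `n - 1` points.

That no further relations are needed is a diamond argument, by induction on the arity. By the
sequential axiom every element of the presented operad is the unit or some `x ∘ᵢ qₙ`. If `x ∘ᵢ qₙ`
and `y ∘ⱼ qₙ'` have the same image, that partition has an interval block starting at `i` and one
starting at `j`. If `i = j` the two blocks coincide and can be cancelled. Otherwise they are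
disjoint, and removing both leaves a partition `z` that underlies `x` and `y`
(`exists_of_comp_p_eq`). Inserting the two blocks into `z` in either order gives the same element
already in the presented operad (`comp_comp_comm`): by the parallel axiom for different gaps of `z`,
and by the defining relation for a common gap, where the blocks become adjacent.

For algebras, the bracket identity is the image of the relations in the endomorphism operad. A
family satisfying it therefore extends to the presented operad, hence along the isomorphism to
partitions, and linearly to their spans. Uniqueness and the criterion for morphisms need checking
only on generators, since both conditions are stable under composition and linear combination. -/

/-! ### Generated operations and the universal property of a presentation -/

namespace NSOperad

/-- Induction principle for generated operations: it suffices to compose with one generator at a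
time, on the right. -/
theorem Generated.right_induction {O : NSOperad} {G : ∀ n : ℕ, O.Op n → Prop}
    {C : ∀ n : ℕ, O.Op n → Prop} (unit : C 1 O.unit)
    (comp_gen : ∀ {m n k : ℕ} (i : ℕ) (hi : i < m) (hk : k + 1 = m + n) (p : O.Op m) (q : O.Op n),
      C m p → G n q → C k (O.comp i hi hk p q))
    {n : ℕ} {x : O.Op n} (hx : O.Generated G n x) : C n x := by
  have key : ∀ {n : ℕ} {q : O.Op n}, O.Generated G n q → ∀ {m k : ℕ} (i : ℕ) (hi : i < m)
      (hk : k + 1 = m + n) (p : O.Op m), C m p → C k (O.comp i hi hk p q) := by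
    intro n q hq
    induction hq with
    | unit =>
      intro m k i hi hk p hp
      obtain rfl : k = m := by omega
      rwa [O.comp_unit]
    | gen q hq =>
      intro m k i hi hk p hp
      exact comp_gen i hi hk p q hp hq
    | @comp a b c j hj hc q r _ _ ihq ihr =>
      intro m k i hi hk p hp
      -- The sequential axiom turns `p ∘ (q ∘ r)` into `(p ∘ q) ∘ r`, so `q` and then `r` can be
      -- absorbed.
      rw [← O.comp_seq (s := m + a - 1) i j hi hj (by omega) hc (by omega) (by omega) hk]
      exact ihr _ _ _ _ (ihq _ _ _ _ hp)
  have h := key hx 0 Nat.one_pos (Nat.add_comm n 1) O.unit unit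
  rwa [O.unit_comp] at h

/-- The evaluation of formal expressions in an operad. -/
def Term.eval {S : ℕ → Type*} (P : NSOperad) (g : ∀ n : ℕ, S n → P.Op n) :
    ∀ {n : ℕ}, Term S n → P.Op n
  | _, .unit => P.unit
  | _, .gen s => g _ s
  | _, .comp i hi hk p q => P.comp i hi hk (p.eval P g) (q.eval P g)

theorem TermEq.eval_eq {S : ℕ → Type*} {R : ∀ n : ℕ, Term S n → Term S n → Prop} {P : NSOperad}
    {g : ∀ n : ℕ, S n → P.Op n} (hg : ∀ n p q, R n p q → p.eval P g = q.eval P g) {n : ℕ}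
    {p q : Term S n} (h : TermEq S R n p q) : p.eval P g = q.eval P g := by
  induction h with
  | rel p q h => exact hg _ p q h
  | refl => rfl
  | symm _ _ _ ih => exact ih.symm
  | trans _ _ _ _ _ ih₁ ih₂ => exact ih₁.trans ih₂
  | comp i hi hk p p' q q' _ _ ih₁ ih₂ => simp only [Term.eval, ih₁, ih₂]
  | unit_comp hi hk q => exact P.unit_comp hi hk _
  | comp_unit i hi hk p => exact P.comp_unit i hi hk _
  | comp_seq i j hi hj hs ht hij hk hk' p q r => exact P.comp_seq i j hi hj hs ht hij hk hk' _ _ _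
  | comp_par i j hle hi hj hs ht hj' hi' hk hk' p q r =>
    exact P.comp_par i j hle hi hj hs ht hj' hi' hk hk' _ _ _

/-- The universal property of the operad with given generators and relations. -/
def presented.lift {S : ℕ → Type*} {R : ∀ n : ℕ, Term S n → Term S n → Prop} {P : NSOperad}
    (g : ∀ n : ℕ, S n → P.Op n) (hg : ∀ n p q, R n p q → p.eval P g = q.eval P g) :
    Hom (presented S R) P where
  map _ := Quot.lift (Term.eval P g) fun _ _ h => h.eval_eq hg
  map_unit := rfl
  map_comp i hi hk p q := by
    induction p using Quot.ind
    induction q using Quot.ind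
    rfl

theorem presented.generated_of {S : ℕ → Type*} {R : ∀ n : ℕ, Term S n → Term S n → Prop} {n : ℕ}
    (x : (presented S R).Op n) :
    (presented S R).Generated (fun _ y => ∃ s, y = presented.of s) n x := by
  induction x using Quot.ind with
  | mk t =>
    induction t with
    | unit => exact .unit
    | gen s => exact .gen _ ⟨s, rfl⟩
    | comp i hi hk p q ihp ihq => exact .comp i hi hk _ _ ihp ihq

end NSOperad

/-! ### Interval blocks of noncrossing partitions and generation -/

namespace gapNCP

theorem parts_comp {m n k : ℕ} (i : ℕ) (hi : i < m) (hk : k + 1 = m + n) (x : gapNCP.Op m)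
    (y : gapNCP.Op n) : (gapNCP.comp i hi hk x y).part.parts =
      gapParts i (n - 1) x.part.parts y.part.parts := rfl

theorem parts_p {n : ℕ} (hn : 2 ≤ n) : (p n hn).part.parts = {Finset.range (n - 1)} := rfl

theorem image_range_add (i b : ℕ) :
    (Finset.range b).image (fun x => x + i) = Finset.Ico i (i + b) := by
  ext x
  simp only [Finset.mem_image, Finset.mem_range, Finset.mem_Ico]
  exact ⟨by rintro ⟨y, hy, rfl⟩; omega, fun h => ⟨x - i, by omega, by omega⟩⟩

theorem mem_parts_comp_p {m n k : ℕ} (i : ℕ) (hi : i < m) (hk : k + 1 = m + n) (hn : 2 ≤ n)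
    (x : gapNCP.Op m) (B : Finset ℕ) :
    B ∈ (gapNCP.comp i hi hk x (p n hn)).part.parts ↔
      (∃ A ∈ x.part.parts, A.image (gapShift i (n - 1)) = B) ∨ B = Finset.Ico i (i + (n - 1)) := by
  rw [parts_comp, parts_p, gapParts, Finset.image_singleton, image_range_add]
  simp [or_comm]

/-- The shift jumps over the inserted interval, so its image misses `i`. Hence the inserted block
can be told apart from the old ones. -/
theorem image_gapShift_ne_Ico {i b : ℕ} (hb : 0 < b) (A : Finset ℕ) :
    A.image (gapShift i b) ≠ Finset.Ico i (i + b) := by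
  intro h
  have : i ∈ A.image (gapShift i b) := by
    rw [h]
    simp [hb]
  obtain ⟨y, -, hy⟩ := Finset.mem_image.1 this
  unfold gapShift at hy
  split_ifs at hy <;> omega

/-- Inserting a one-block partition into a fixed gap is injective. -/
theorem comp_p_injective {m n k : ℕ} (i : ℕ) (hi : i < m) (hk : k + 1 = m + n) (hn : 2 ≤ n)
    {x y : gapNCP.Op m}
    (h : gapNCP.comp i hi hk x (p n hn) = gapNCP.comp i hi hk y (p n hn)) : x = y := by
  have key : ∀ x y : gapNCP.Op m,
      gapNCP.comp i hi hk x (p n hn) = gapNCP.comp i hi hk y (p n hn) →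
      x.part.parts ⊆ y.part.parts := by
    intro x y h A hA
    have h₁ := (mem_parts_comp_p i hi hk hn x _).2 (Or.inl ⟨A, hA, rfl⟩)
    rw [h, mem_parts_comp_p] at h₁
    rcases h₁ with ⟨A', hA', h₁⟩ | h₁
    · rwa [← Finset.image_injective (gapShift_strictMono _ _).injective h₁]
    · exact absurd h₁ (image_gapShift_ne_Ico (by omega) A)
  exact GapNCP.ext_parts ((key x y h).antisymm (key y x h.symm))

theorem disjoint_of_mem_parts {n : ℕ} (x : gapNCP.Op n) {A B : Finset ℕ} (hA : A ∈ x.part.parts)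
    (hB : B ∈ x.part.parts) (hAB : A ≠ B) {a : ℕ} (ha : a ∈ A) : a ∉ B := fun hb =>
  Finset.disjoint_left.1 (x.part.disjoint hA hB hAB) ha hb

/-- A noncrossing partition with a block that is an interval arises by inserting that block. -/
theorem exists_eq_comp_p {m n k : ℕ} (i : ℕ) (hi : i < m) (hk : k + 1 = m + n) (hn : 2 ≤ n)
    (z : gapNCP.Op k) (hz : Finset.Ico i (i + (n - 1)) ∈ z.part.parts) :
    ∃ x : gapNCP.Op m, z = gapNCP.comp i hi hk x (p n hn) := by
  set I := Finset.Ico i (i + (n - 1)) with hI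
  set g := gapShift i (n - 1) with hg
  have ginj : Function.Injective g := (gapShift_strictMono _ _).injective
  -- A block other than `I` is disjoint from `I`, and the points outside `I` are exactly the values
  -- of `g`.
  have hmem : ∀ A ∈ z.part.parts, A ≠ I → ∀ a ∈ A, ∃ b, b < m - 1 ∧ g b = a := by
    intro A hA hAI a ha
    have h₁ := disjoint_of_mem_parts z hA hz hAI ha
    have h₂ := Finset.mem_range.1 (z.part.le hA ha)
    rw [hI, Finset.mem_Ico] at h₁
    by_cases h : a < i
    · exact ⟨a, by omega, by simp [hg, gapShift, h]⟩
    · exact ⟨a - (n - 1), by omega, by simp only [hg, gapShift]; split_ifs <;> omega⟩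
  have himg : ∀ A ∈ z.part.parts, A ≠ I →
      (A.preimage g ginj.injOn).image g = A := by
    intro A hA hAI
    ext a
    simp only [Finset.mem_image, Finset.mem_preimage]
    refine ⟨by rintro ⟨b, hb, rfl⟩; exact hb, fun ha => ?_⟩
    obtain ⟨b, -, rfl⟩ := hmem A hA hAI a ha
    exact ⟨b, ha, rfl⟩
  have hgI : ∀ a, g a ∉ I := by
    intro a
    simp only [hg, hI, gapShift, Finset.mem_Ico]
    split_ifs <;> omega
  -- The partition left after deleting `I`, with the remaining points renumbered by the inverse of
  -- `g`.
  let Q : Finpartition (Finset.range (m - 1)) := Finpartition.ofExistsUnique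
    ((z.part.parts.erase I).image fun A => A.preimage g ginj.injOn)
    (by
      intro T hT b hb
      obtain ⟨A, hA, rfl⟩ := Finset.mem_image.1 hT
      obtain ⟨hAI, hA⟩ := Finset.mem_erase.1 hA
      obtain ⟨c, hc, hcb⟩ := hmem A hA hAI _ (Finset.mem_preimage.1 hb)
      rw [← ginj hcb]
      exact Finset.mem_range.2 hc)
    (by
      intro b hb
      have hb := Finset.mem_range.1 hb
      obtain ⟨A, ⟨hA, hbA⟩, huA⟩ := z.part.existsUnique_mem (a := g b) (by
        simp only [hg, gapShift, Finset.mem_range]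
        split_ifs <;> omega)
      refine ⟨A.preimage g ginj.injOn, ⟨Finset.mem_image_of_mem _ (Finset.mem_erase.2 ⟨?_, hA⟩),
        Finset.mem_preimage.2 hbA⟩, ?_⟩
      · rintro rfl
        exact hgI b hbA
      · rintro T ⟨hT, hbT⟩
        obtain ⟨A', hA', rfl⟩ := Finset.mem_image.1 hT
        rw [huA A' ⟨(Finset.mem_erase.1 hA').2, Finset.mem_preimage.1 hbT⟩])
    (by
      intro h
      obtain ⟨A, hA, hA0⟩ := Finset.mem_image.1 h
      obtain ⟨hAI, hA⟩ := Finset.mem_erase.1 hA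
      have := himg A hA hAI
      rw [hA0, Finset.image_empty] at this
      exact z.part.ne_bot hA this.symm)
  refine ⟨⟨by omega, Q, ?_⟩, ?_⟩
  · intro T hT U hU hTU
    obtain ⟨A, hA, rfl⟩ := Finset.mem_image.1 hT
    obtain ⟨B, hB, rfl⟩ := Finset.mem_image.1 hU
    rintro ⟨a, ha, b, hb, c, hc, d, hd, h₁, h₂, h₃⟩
    refine z.noncrossing A (Finset.mem_erase.1 hA).2 B (Finset.mem_erase.1 hB).2
      (fun h => hTU (by rw [h])) ⟨g a, Finset.mem_preimage.1 ha, g b, Finset.mem_preimage.1 hb,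
        g c, Finset.mem_preimage.1 hc, g d, Finset.mem_preimage.1 hd, ?_, ?_, ?_⟩ <;>
    exact gapShift_strictMono _ _ ‹_›
  · apply GapNCP.ext_parts
    ext B
    refine Iff.trans ?_ (mem_parts_comp_p i hi hk hn _ B).symm
    constructor
    · intro hB
      by_cases hBI : B = I
      · exact Or.inr hBI
      · exact Or.inl ⟨_, Finset.mem_image_of_mem _ (Finset.mem_erase.2 ⟨hBI, hB⟩), himg B hB hBI⟩
    · rintro (⟨T, hT, rfl⟩ | rfl)
      · obtain ⟨A, hA, rfl⟩ := Finset.mem_image.1 hT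
        obtain ⟨hAI, hA⟩ := Finset.mem_erase.1 hA
        rwa [himg A hA hAI]
      · exact hz

/-- A noncrossing partition of a nonempty set has a block that is an interval. -/
theorem exists_Ico_mem_parts {k : ℕ} (hk : 2 ≤ k) (z : gapNCP.Op k) :
    ∃ i b : ℕ, 0 < b ∧ Finset.Ico i (i + b) ∈ z.part.parts := by
  have hne : z.part.parts.Nonempty := by
    obtain ⟨A, ⟨hA, -⟩, -⟩ := z.part.existsUnique_mem (a := 0) (Finset.mem_range.2 (by omega))
    exact ⟨A, hA⟩
  -- A block of least span `max - min`; it is shown to have no holes.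
  obtain ⟨A, hA, hmin⟩ := Finset.exists_min_image z.part.parts
    (fun A => A.sup id - sInf (A : Set ℕ)) hne
  have hAne := z.part.nonempty_of_mem_parts hA
  have hspan : ∀ B ∈ z.part.parts, sInf (B : Set ℕ) ∈ B ∧ B.sup id ∈ B ∧
      ∀ b ∈ B, sInf (B : Set ℕ) ≤ b ∧ b ≤ B.sup id := by
    intro B hB
    have hBne := z.part.nonempty_of_mem_parts hB
    refine ⟨Nat.sInf_mem (s := (B : Set ℕ)) hBne, ?_, fun b hb => ⟨Nat.sInf_le hb,
      Finset.le_sup (f := id) hb⟩⟩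
    obtain ⟨b, hb, h⟩ := Finset.exists_mem_eq_sup B hBne id
    rw [h]
    exact hb
  obtain ⟨ha, hb, hab⟩ := hspan A hA
  set a := sInf (A : Set ℕ)
  set b := A.sup id
  have hle := (hab a ha).2
  refine ⟨a, b + 1 - a, by omega, ?_⟩
  suffices h : Finset.Ico a (a + (b + 1 - a)) = A by rwa [h]
  ext c
  rw [Finset.mem_Ico]
  constructor
  · intro hc
    by_contra hcA
    have hbk := Finset.mem_range.1 (z.part.le hA hb)
    obtain ⟨B, ⟨hB, hcB⟩, -⟩ := z.part.existsUnique_mem (a := c) (Finset.mem_range.2 (by omega))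
    have hAB : A ≠ B := fun h => hcA (h ▸ hcB)
    have hac : a < c := lt_of_le_of_ne hc.1 fun h => hcA (h ▸ ha)
    have hcb : c < b := lt_of_le_of_ne (by omega) fun h => hcA (h ▸ hb)
    -- The block `B` contains the hole `c`. A point of `B` below `a` or above `b` would make `A` and
    -- `B` cross, so `B` has strictly smaller span than `A`, against minimality.
    have hBsub : ∀ d ∈ B, a < d ∧ d ≤ b := by
      intro d hd
      constructor
      · by_contra hda
        have hne : d ≠ a := fun h => disjoint_of_mem_parts z hA hB hAB ha (h ▸ hd)
        exact z.noncrossing B hB A hA hAB.symm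
          ⟨d, hd, c, hcB, a, ha, b, hb, by omega, hac, hcb⟩
      · by_contra hdb
        exact z.noncrossing A hA B hB hAB ⟨a, ha, b, hb, c, hcB, d, hd, hac, hcb, by omega⟩
    obtain ⟨h₁, h₂, -⟩ := hspan B hB
    have h₃ := hmin B hB
    have h₄ := hBsub _ h₁
    have h₅ := hBsub _ h₂
    change b - a ≤ B.sup id - sInf (B : Set ℕ) at h₃
    omega
  · intro hc
    have := hab c hc
    omega

theorem eq_unit (x : gapNCP.Op 1) : x = gapNCP.unit := by
  apply GapNCP.ext_parts
  rw [Finset.eq_empty_of_forall_notMem (s := x.part.parts)]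
  · rfl
  · intro A hA
    obtain ⟨a, ha⟩ := x.part.nonempty_of_mem_parts hA
    exact absurd (Finset.mem_range.1 (x.part.le hA ha)) (Nat.not_lt_zero a)

theorem generated_p (n : ℕ) (x : gapNCP.Op n) :
    gapNCP.Generated (fun n y => ∃ hn : 2 ≤ n, y = gapNCP.p n hn) n x := by
  induction n using Nat.strong_induction_on with
  | _ n ih =>
    rcases lt_trichotomy n 1 with h | rfl | h
    · have := x.arity_pos
      omega
    · rw [eq_unit x]
      exact .unit
    · obtain ⟨i, b, hb, hz⟩ := exists_Ico_mem_parts h x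
      have hle : i + (b - 1) < n - 1 :=
        Finset.mem_range.1 (x.part.le hz (Finset.mem_Ico.2 (by omega)))
      -- An interval block with `b` points is an inserted `p` of arity `b + 1`; removing it lowers
      -- the arity by `b`.
      obtain ⟨y, hy⟩ := exists_eq_comp_p (m := n - b) (n := b + 1) i (by omega) (by omega)
        (by omega) x (by simpa using hz)
      rw [hy]
      exact .comp _ _ _ _ _ (ih _ (by omega) y) (.gen _ ⟨_, rfl⟩)

theorem comp_p_last (m n k : ℕ) (hm : 2 ≤ m) (hn : 2 ≤ n) (hk : k + 1 = m + n) :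
    gapNCP.comp (m - 1) (by omega) hk (p m hm) (p n hn) =
      gapNCP.comp 0 (by omega) (hk.trans (Nat.add_comm m n)) (p n hn) (p m hm) := by
  apply GapNCP.ext_parts
  have e₁ : (Finset.range (m - 1)).image (gapShift (m - 1) (n - 1)) = Finset.range (m - 1) := by
    refine (Finset.image_congr fun x hx => ?_).trans Finset.image_id
    simp [gapShift, Finset.mem_range.1 hx]
  have e₂ : gapShift 0 (m - 1) = fun x => x + (m - 1) := by
    funext x
    simp [gapShift]
  simp only [parts_comp, parts_p, gapParts, Finset.image_singleton, e₁, e₂]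
  rw [Finset.union_comm]
  simp

end gapNCP

/-! ### Interchange of generators and injectivity on the presented operad -/

/-- Composites with two members of a family of operations that satisfies the relations of the
one-block partitions can be interchanged. -/
theorem NSOperad.comp_comp_comm {O : NSOperad} (e : ∀ n : ℕ, 2 ≤ n → O.Op n)
    (he : ∀ (m n k : ℕ) (hm : 2 ≤ m) (hn : 2 ≤ n) (hk : k + 1 = m + n),
      O.comp (m - 1) (by omega) hk (e m hm) (e n hn) =
        O.comp 0 (by omega) (hk.trans (Nat.add_comm m n)) (e n hn) (e m hm))
    {r m n s t k : ℕ} (i j : ℕ) (hij : i ≤ j) (hi : i < r) (hj : j < r) (hm : 2 ≤ m) (hn : 2 ≤ n)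
    (hs : s + 1 = r + n) (ht : t + 1 = r + m) (hj' : j + (n - 1) < s) (hi' : i < t)
    (hk : k + 1 = s + m) (hk' : k + 1 = t + n) (z : O.Op r) :
    O.comp (j + (n - 1)) hj' hk (O.comp i hi hs z (e n hn)) (e m hm) =
      O.comp i hi' hk' (O.comp j hj ht z (e m hm)) (e n hn) := by
  rcases hij.eq_or_lt with rfl | hlt
  -- Same gap: after sequential reassociation the two sides are `z ∘ᵢ (eₙ ∘ eₘ)`, with `eₘ` in the
  -- last slot, and `z ∘ᵢ (eₘ ∘ eₙ)`, with `eₙ` in the first slot; these agree by `he`.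
  · rw [O.comp_seq i (n - 1) hi (by omega) hs (t := n + m - 1) (by omega) hj' hk (by omega), he]
    exact (O.comp_seq i 0 hi (by omega) ht (by omega) hi' hk' (by omega) _ _ _).symm
  -- Different gaps: this is the parallel axiom, whose second slot has the form `j + 1`.
  · obtain ⟨j, rfl⟩ : ∃ j', j = j' + 1 := ⟨j - 1, by omega⟩
    have := O.comp_par i j (by omega) hi hj hs ht (by omega) hi' hk hk' z (e n hn) (e m hm)
    simpa only [show j + 1 + (n - 1) = j + n by omega] using this

namespace gapNCP

theorem Ico_mem_parts_comp_p {m n k : ℕ} (i : ℕ) (hi : i < m) (hk : k + 1 = m + n) (hn : 2 ≤ n)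
    (x : gapNCP.Op m) :
    Finset.Ico i (i + (n - 1)) ∈ (gapNCP.comp i hi hk x (p n hn)).part.parts :=
  (mem_parts_comp_p i hi hk hn x _).2 (Or.inr rfl)

/-- Both inserted blocks contain `i`, so they are the same block and have the same size. -/
theorem arity_eq_of_comp_p_eq {m m' n n' k : ℕ} (i : ℕ) (hi : i < m) (hi' : i < m')
    (hk : k + 1 = m + n) (hk' : k + 1 = m' + n') (hn : 2 ≤ n) (hn' : 2 ≤ n') {x : gapNCP.Op m}
    {y : gapNCP.Op m'}
    (h : gapNCP.comp i hi hk x (p n hn) = gapNCP.comp i hi' hk' y (p n' hn')) : n = n' := by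
  have h₁ := Ico_mem_parts_comp_p i hi hk hn x
  have h₂ := Ico_mem_parts_comp_p i hi' hk' hn' y
  rw [← h] at h₂
  by_contra hne
  refine disjoint_of_mem_parts _ h₁ h₂ (fun h => ?_) (a := i)
    (Finset.mem_Ico.2 (by omega)) (Finset.mem_Ico.2 (by omega))
  have := congrArg Finset.card h
  simp only [Nat.card_Ico] at this
  omega

/-- The diamond: two ways of removing an interval block from one partition are completed by removing
both blocks, which leaves `z`. The index `d` is the gap of the second block once the first one is
removed. -/
theorem exists_of_comp_p_eq {m m' n n' k : ℕ} {i j : ℕ} (hi : i < m) (hj : j < m')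
    (hk : k + 1 = m + n) (hk' : k + 1 = m' + n') (hn : 2 ≤ n) (hn' : 2 ≤ n') {x : gapNCP.Op m}
    {y : gapNCP.Op m'}
    (h : gapNCP.comp i hi hk x (p n hn) = gapNCP.comp j hj hk' y (p n' hn')) (hij : i < j) :
    ∃ (r d : ℕ) (hr : m + 1 = r + n') (hr' : m' + 1 = r + n) (hd : d < r) (hid : i ≤ d)
      (z : gapNCP.Op r), j = d + (n - 1) ∧ x = gapNCP.comp d hd hr z (p n' hn') ∧
        y = gapNCP.comp i (hid.trans_lt hd) hr' z (p n hn) := by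
  have h₁ := Ico_mem_parts_comp_p i hi hk hn x
  have h₂ := Ico_mem_parts_comp_p j hj hk' hn' y
  rw [← h] at h₂
  have hne : Finset.Ico j (j + (n' - 1)) ≠ Finset.Ico i (i + (n - 1)) := by
    intro e
    have : i ∈ Finset.Ico j (j + (n' - 1)) := by
      rw [e]
      exact Finset.mem_Ico.2 (by omega)
    rw [Finset.mem_Ico] at this
    omega
  -- Distinct blocks are disjoint, so `j > i` lies beyond the whole interval that starts at `i`.
  have hle : i + (n - 1) ≤ j := by
    have := disjoint_of_mem_parts _ h₂ h₁ hne (a := j) (Finset.mem_Ico.2 (by omega))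
    rw [Finset.mem_Ico] at this
    omega
  obtain ⟨d, rfl⟩ : ∃ d, j = d + (n - 1) := ⟨j - (n - 1), by omega⟩
  have hx : Finset.Ico d (d + (n' - 1)) ∈ x.part.parts := by
    rcases (mem_parts_comp_p i hi hk hn x _).1 h₂ with ⟨A, hA, e⟩ | e
    · have : Finset.Ico d (d + (n' - 1)) = A := by
        apply Finset.image_injective (gapShift_strictMono i (n - 1)).injective
        rw [e]
        ext a
        simp only [Finset.mem_image, Finset.mem_Ico]
        constructor
        · rintro ⟨b, hb, rfl⟩
          simp only [gapShift]
          split_ifs <;> omega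
        · intro ha
          refine ⟨a - (n - 1), by omega, ?_⟩
          simp only [gapShift]
          split_ifs <;> omega
      rwa [this]
    · exact absurd e hne
  have hdlt : d + (n' - 1) - 1 < m - 1 :=
    Finset.mem_range.1 (x.part.le hx (Finset.mem_Ico.2 (by omega)))
  obtain ⟨z, hz⟩ := exists_eq_comp_p (m := m + 1 - n') d (by omega) (by omega) hn' x hx
  refine ⟨m + 1 - n', d, by omega, by omega, by omega, by omega, z, rfl, hz, ?_⟩
  -- The form of `y` follows by cancelling the second block, after interchanging the two insertions
  -- into `z`.
  apply comp_p_injective _ hj hk' hn'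
  rw [← h, hz]
  exact (NSOperad.comp_comp_comm p comp_p_last i d (by omega) (by omega) (by omega) hn' hn _ _ _ _ _ _ z).symm

/-- The operad with the formal generators and relations of the one-block partitions. -/
abbrev Presented : NSOperad := NSOperad.presented GapGen GapRel

/-- The formal generator of arity `n`. -/
def q (n : ℕ) (hn : 2 ≤ n) : Presented.Op n := NSOperad.presented.of (PLift.up hn)

theorem comp_q_last (m n k : ℕ) (hm : 2 ≤ m) (hn : 2 ≤ n) (hk : k + 1 = m + n) :
    Presented.comp (m - 1) (by omega) hk (q m hm) (q n hn) =
      Presented.comp 0 (by omega) (hk.trans (Nat.add_comm m n)) (q n hn) (q m hm) :=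
  Quot.sound (.rel _ _ (GapRel.mk hm hn hk))

/-- The morphism from the presented operad to an operad with operations that satisfy the
relations. -/
def lift {O : NSOperad} (e : ∀ n : ℕ, 2 ≤ n → O.Op n)
    (he : ∀ (m n k : ℕ) (hm : 2 ≤ m) (hn : 2 ≤ n) (hk : k + 1 = m + n),
      O.comp (m - 1) (by omega) hk (e m hm) (e n hn) =
        O.comp 0 (by omega) (hk.trans (Nat.add_comm m n)) (e n hn) (e m hm)) :
    NSOperad.Hom Presented O :=
  NSOperad.presented.lift (fun n s => e n s.down) (by
    rintro _ _ _ ⟨hm, hn, hk⟩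
    exact he _ _ _ hm hn hk)

/-- The morphism from the presented operad to the operad of noncrossing partitions. -/
def toGapNCP : NSOperad.Hom Presented gapNCP := lift p comp_p_last

theorem toGapNCP_q (n : ℕ) (hn : 2 ≤ n) : toGapNCP.map n (q n hn) = p n hn := rfl

theorem toGapNCP_comp_q {m n k : ℕ} (i : ℕ) (hi : i < m) (hk : k + 1 = m + n) (hn : 2 ≤ n)
    (x : Presented.Op m) : toGapNCP.map k (Presented.comp i hi hk x (q n hn)) =
      gapNCP.comp i hi hk (toGapNCP.map m x) (p n hn) :=
  toGapNCP.map_comp i hi hk x (q n hn)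

theorem toGapNCP_surjective (n : ℕ) : Function.Surjective (toGapNCP.map n) := by
  intro x
  induction generated_p n x with
  | unit => exact ⟨Presented.unit, toGapNCP.map_unit⟩
  | gen x hx =>
    obtain ⟨hn, rfl⟩ := hx
    exact ⟨q _ hn, rfl⟩
  | comp i hi hk x y _ _ ihx ihy =>
    obtain ⟨x, rfl⟩ := ihx
    obtain ⟨y, rfl⟩ := ihy
    exact ⟨Presented.comp i hi hk x y, toGapNCP.map_comp i hi hk x y⟩

/-- The formal counterpart of removing an interval block: every element other than the unit has a
last generator grafted on. -/
theorem eq_unit_or_exists_comp_q {n : ℕ} (x : Presented.Op n) :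
    (∃ h : n = 1, x = h ▸ Presented.unit) ∨ ∃ (m l i : ℕ) (hi : i < m) (hk : n + 1 = m + l)
      (hl : 2 ≤ l) (y : Presented.Op m), x = Presented.comp i hi hk y (q l hl) := by
  refine NSOperad.Generated.right_induction (C := fun n x => (∃ h : n = 1, x = h ▸ Presented.unit) ∨
    ∃ (m l i : ℕ) (hi : i < m) (hk : n + 1 = m + l) (hl : 2 ≤ l) (y : Presented.Op m),
      x = Presented.comp i hi hk y (q l hl)) (Or.inl ⟨rfl, rfl⟩) ?_
    (NSOperad.presented.generated_of x)
  rintro m n k i hi hk x _ - ⟨⟨hn⟩, rfl⟩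
  exact Or.inr ⟨m, n, i, hi, hk, hn, x, rfl⟩

/-- The diamond lifts to the presented operad: `z` lifts by surjectivity, the induction hypothesis
identifies `x` and `y` with composites of that lift, and these composites interchange. -/
theorem comp_q_eq_of_lt {m m' n n' k : ℕ}
    (ih : ∀ l < k, Function.Injective (toGapNCP.map l)) {i j : ℕ} (hi : i < m) (hj : j < m')
    (hk : k + 1 = m + n) (hk' : k + 1 = m' + n') (hn : 2 ≤ n) (hn' : 2 ≤ n') {x : Presented.Op m}
    {y : Presented.Op m'}
    (h : toGapNCP.map k (Presented.comp i hi hk x (q n hn)) =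
      toGapNCP.map k (Presented.comp j hj hk' y (q n' hn'))) (hij : i < j) :
    Presented.comp i hi hk x (q n hn) = Presented.comp j hj hk' y (q n' hn') := by
  rw [toGapNCP_comp_q, toGapNCP_comp_q] at h
  obtain ⟨r, d, hr, hr', hd, hid, z, rfl, hx, hy⟩ := exists_of_comp_p_eq hi hj hk hk' hn hn' h hij
  obtain ⟨z, rfl⟩ := toGapNCP_surjective r z
  rw [← toGapNCP_comp_q] at hx hy
  rw [ih m (by omega) hx, ih m' (by omega) hy]
  exact (NSOperad.comp_comp_comm q comp_q_last i d hid _ hd hn' hn _ _ _ _ _ _ z).symm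

theorem toGapNCP_injective (n : ℕ) : Function.Injective (toGapNCP.map n) := by
  induction n using Nat.strong_induction_on with
  | _ k ih =>
    intro x y h
    rcases eq_unit_or_exists_comp_q x with ⟨h₁, hx⟩ | ⟨m, n, i, hi, hk, hn, x, rfl⟩ <;>
      rcases eq_unit_or_exists_comp_q y with ⟨h₂, hy⟩ | ⟨m', n', j, hj, hk', hn', y, rfl⟩
    · rw [hx, hy]
    · omega
    · omega
    · rcases lt_trichotomy i j with hij | rfl | hij
      · exact comp_q_eq_of_lt ih hi hj hk hk' hn hn' h hij
      · have h' := h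
        rw [toGapNCP_comp_q, toGapNCP_comp_q] at h'
        obtain rfl := arity_eq_of_comp_p_eq i hi hj hk hk' hn hn' h'
        obtain rfl : m = m' := by omega
        rw [ih m (by omega) (comp_p_injective i hi hk hn h')]
      · exact (comp_q_eq_of_lt ih hj hi hk' hk hn' hn h.symm hij).symm

theorem toGapNCP_bijective (n : ℕ) : Function.Bijective (toGapNCP.map n) :=
  ⟨toGapNCP_injective n, toGapNCP_surjective n⟩

end gapNCP

/-! ### The endomorphism operad and algebras from operad morphisms -/

/-- The arguments of the outer operation in a composite, where the value of the inner operation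
is `y`. -/
def endArg {V : Type*} {m n k : ℕ} (i : ℕ) (hi : i < m) (hk : k + 1 = m + n) (y : V) (v : Fin k → V)
    (j : Fin m) : V :=
  if h₁ : j.val < i then v ⟨j.val, by omega⟩
  else if h₂ : j.val = i then y
  else v ⟨j.val + n - 1, by omega⟩

/-- The arguments of the inner operation in a composite. -/
def endBlock {V : Type*} {m n k : ℕ} (i : ℕ) (hi : i < m) (hk : k + 1 = m + n) (v : Fin k → V)
    (l : Fin n) : V :=
  v ⟨i + l.val, by omega⟩

theorem endComp_eq_endArg {V : Type*} {m n k : ℕ} (i : ℕ) (hi : i < m) (hk : k + 1 = m + n)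
    (f : (Fin m → V) → V) (g : (Fin n → V) → V) (v : Fin k → V) :
    endComp i hi hk f g v = f (endArg i hi hk (g (endBlock i hi hk v)) v) := rfl

/-- Isolates the dependence on the inner value in slot `i`, which makes composition linear in the
inner operation. -/
theorem endArg_eq_update {V : Type*} {m n k : ℕ} (i : ℕ) (hi : i < m) (hk : k + 1 = m + n)
    (y y' : V) (v : Fin k → V) :
    endArg i hi hk y v = Function.update (endArg i hi hk y' v) ⟨i, hi⟩ y := by
  funext j
  by_cases h : j = ⟨i, hi⟩
  · subst h
    simp [endArg]
  · rw [Function.update_of_ne h]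
    have : j.val ≠ i := fun e => h (Fin.ext e)
    simp [endArg, this]

theorem endComp_unit_left {V : Type*} {n : ℕ} (hi : 0 < 1) (hk : n + 1 = 1 + n)
    (g : (Fin n → V) → V) (v : Fin n → V) : endComp 0 hi hk (fun w : Fin 1 → V => w 0) g v = g v := by
  simp [endComp]

theorem endComp_unit_right {V : Type*} {m : ℕ} (i : ℕ) (hi : i < m) (hk : m + 1 = m + 1)
    (f : (Fin m → V) → V) (v : Fin m → V) :
    endComp i hi hk f (fun w : Fin 1 → V => w 0) v = f v := by
  unfold endComp
  congr 1
  funext j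
  split_ifs with h₁ h₂
  · rfl
  · exact congrArg v (Fin.ext (by simp [h₂]))
  · exact congrArg v (Fin.ext (by simp))

theorem endComp_seq {V : Type*} {m n l s t k : ℕ} (i j : ℕ) (hi : i < m) (hj : j < n)
    (hs : s + 1 = m + n) (ht : t + 1 = n + l) (hij : i + j < s) (hk : k + 1 = s + l)
    (hk' : k + 1 = m + t) (f : (Fin m → V) → V) (g : (Fin n → V) → V) (h : (Fin l → V) → V)
    (v : Fin k → V) :
    endComp (i + j) hij hk (endComp i hi hs f g) h v =
      endComp i hi hk' f (endComp j hj ht g h) v := by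
  unfold endComp
  congr 1
  funext a
  dsimp only
  by_cases h₁ : a.val < i
  · rw [dif_pos h₁, dif_pos h₁, dif_pos (by omega)]
  rw [dif_neg h₁, dif_neg h₁]
  by_cases h₂ : a.val = i
  · rw [dif_pos h₂, dif_pos h₂]
    congr 1
    funext b
    by_cases h₃ : b.val < j
    · rw [dif_pos (by omega), dif_pos h₃]
    rw [dif_neg (by omega), dif_neg h₃]
    by_cases h₄ : b.val = j
    · rw [dif_pos (by omega), dif_pos h₄]
      congr 1
      funext c
      exact congrArg v (Fin.ext (by simp only; omega))
    · rw [dif_neg (by omega), dif_neg h₄]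
      exact congrArg v (Fin.ext (by simp only; omega))
  · rw [dif_neg h₂, dif_neg h₂, dif_neg (by omega), dif_neg (by omega)]
    exact congrArg v (Fin.ext (by simp only; omega))

theorem endComp_par {V : Type*} {m n l s t k : ℕ} (i j : ℕ) (hle : i ≤ j) (hi : i < m)
    (hj : j + 1 < m) (hs : s + 1 = m + n) (ht : t + 1 = m + l) (hj' : j + n < s) (hi' : i < t)
    (hk : k + 1 = s + l) (hk' : k + 1 = t + n) (f : (Fin m → V) → V) (g : (Fin n → V) → V)
    (h : (Fin l → V) → V) (v : Fin k → V) :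
    endComp (j + n) hj' hk (endComp i hi hs f g) h v =
      endComp i hi' hk' (endComp (j + 1) hj ht f h) g v := by
  unfold endComp
  congr 1
  funext a
  dsimp only
  by_cases h₁ : a.val < i
  · rw [dif_pos h₁, dif_pos (by omega), dif_pos (by omega), dif_pos (by omega)]
  rw [dif_neg h₁]
  by_cases h₂ : a.val = i
  · rw [dif_pos h₂, dif_pos (by omega), dif_neg (by omega), dif_pos (by omega)]
    congr 1
    funext b
    rw [dif_pos (by omega)]
  rw [dif_neg h₂]
  by_cases h₃ : a.val < j + 1
  · rw [dif_pos h₃, dif_pos (by omega), dif_neg (by omega),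
      dif_neg (by omega)]
  rw [dif_neg h₃, dif_neg (by omega)]
  by_cases h₄ : a.val = j + 1
  · rw [dif_pos h₄, dif_pos (by omega)]
    congr 1
    funext b
    rw [dif_neg (by omega), dif_neg (by omega)]
    exact congrArg v (Fin.ext (by simp only; omega))
  · rw [dif_neg h₄, dif_neg (by omega), dif_neg (by omega),
      dif_neg (by omega)]
    exact congrArg v (Fin.ext (by simp only; omega))

theorem map_endComp {V W : Type*} {m n k : ℕ} (i : ℕ) (hi : i < m) (hk : k + 1 = m + n) (f : V → W)
    {g : (Fin m → V) → V} {g' : (Fin m → W) → W} {h : (Fin n → V) → V} {h' : (Fin n → W) → W}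
    (hg : ∀ v, f (g v) = g' fun j => f (v j)) (hh : ∀ v, f (h v) = h' fun j => f (v j))
    (v : Fin k → V) : f (endComp i hi hk g h v) = endComp i hi hk g' h' fun j => f (v j) := by
  unfold endComp
  rw [hg]
  congr 1
  funext j
  split_ifs
  · rfl
  · exact hh _
  · rfl

section Multilinear

variable {K : Type*} [Field K] {V : Type*} [AddCommGroup V] [Module K V]

/-- Each variable reaches the outer operation through a single slot, and linearly: by the identity
if it lies outside the inner block, and through `g` in one variable if it lies inside.
Multilinearity of the composite follows. -/
theorem endArg_update {m n k : ℕ} (i : ℕ) (hi : i < m) (hk : k + 1 = m + n)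
    (g : MultilinearMap K (fun _ : Fin n => V) V) (v : Fin k → V) (c : Fin k) :
    ∃ (a : Fin m) (L : V →ₗ[K] V), ∀ x : V,
      endArg i hi hk (g (endBlock i hi hk (Function.update v c x))) (Function.update v c x) =
        Function.update (endArg i hi hk (g (endBlock i hi hk v)) v) a (L x) := by
  have hne : ∀ {d : Fin k} (x : V), d.val ≠ c.val → Function.update v c x d = v d :=
    fun x h => Function.update_of_ne (fun e => h (congrArg Fin.val e)) _ _
  have heq : ∀ {d : Fin k} (x : V), d.val = c.val → Function.update v c x d = x := by
    rintro d x h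
    rw [Fin.ext h, Function.update_self]
  have hblock : c.val < i ∨ i + n ≤ c.val → ∀ x,
      endBlock i hi hk (Function.update v c x) = endBlock i hi hk v :=
    fun h x => funext fun l => hne x (by simp only; omega)
  by_cases h₁ : c.val < i
  · refine ⟨⟨c.val, by omega⟩, LinearMap.id, fun x => funext fun j => ?_⟩
    rw [hblock (Or.inl h₁)]
    by_cases h : j = ⟨c.val, by omega⟩
    · subst h
      rw [Function.update_self]
      unfold endArg
      rw [dif_pos h₁, heq x rfl]
      rfl
    · have hj : j.val ≠ c.val := fun e => h (Fin.ext e)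
      rw [Function.update_of_ne h]
      unfold endArg
      split_ifs
      · exact hne x hj
      · rfl
      · exact hne x (by simp only; omega)
  by_cases h₂ : i + n ≤ c.val
  -- To the right of the block, the `n` inner inputs are contracted to one slot, which lowers
  -- positions by `n - 1`.
  · refine ⟨⟨c.val + 1 - n, by omega⟩, LinearMap.id, fun x => funext fun j => ?_⟩
    rw [hblock (Or.inr h₂)]
    by_cases h : j = ⟨c.val + 1 - n, by omega⟩
    · subst h
      rw [Function.update_self]
      unfold endArg
      rw [dif_neg (by simp only; omega), dif_neg (by simp only; omega),
        heq x (by simp only; omega)]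
      rfl
    · have hj : j.val ≠ c.val + 1 - n := fun e => h (Fin.ext e)
      rw [Function.update_of_ne h]
      unfold endArg
      split_ifs
      · exact hne x (by simp only; omega)
      · rfl
      · exact hne x (by simp only; omega)
  · refine ⟨⟨i, hi⟩, g.toLinearMap (endBlock i hi hk v) ⟨c.val - i, by omega⟩, fun x => ?_⟩
    have hb : endBlock i hi hk (Function.update v c x) =
        Function.update (endBlock i hi hk v) ⟨c.val - i, by omega⟩ x := by
      funext l
      by_cases h : l = ⟨c.val - i, by omega⟩
      · subst h
        rw [Function.update_self]
        exact heq x (by simp only; omega)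
      · have hl : l.val ≠ c.val - i := fun e => h (Fin.ext e)
        rw [Function.update_of_ne h]
        exact hne x (by simp only; omega)
    rw [hb]
    funext j
    by_cases h : j = ⟨i, hi⟩
    · subst h
      rw [Function.update_self]
      unfold endArg
      rw [dif_neg (lt_irrefl i), dif_pos rfl]
      rfl
    · have hj : j.val ≠ i := fun e => h (Fin.ext e)
      rw [Function.update_of_ne h]
      unfold endArg
      split_ifs
      · exact hne x (by simp only; omega)
      · exact hne x (by simp only; omega)

/-- Composition in the endomorphism operad, as a multilinear map. -/
def endCompMultilinear {m n k : ℕ} (i : ℕ) (hi : i < m) (hk : k + 1 = m + n)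
    (f : MultilinearMap K (fun _ : Fin m => V) V) (g : MultilinearMap K (fun _ : Fin n => V) V) :
    MultilinearMap K (fun _ : Fin k => V) V where
  toFun := endComp i hi hk f g
  map_update_add' := by
    intro inst v c x y
    -- The field quantifies over all decidability instances, while `endArg_update` uses the standard
    -- one.
    obtain rfl : inst = instDecidableEqFin k := Subsingleton.elim _ _
    obtain ⟨a, L, h⟩ := endArg_update i hi hk g v c
    simp only [endComp_eq_endArg, h, map_add, f.map_update_add]
  map_update_smul' := by
    intro inst v c r x
    obtain rfl : inst = instDecidableEqFin k := Subsingleton.elim _ _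
    obtain ⟨a, L, h⟩ := endArg_update i hi hk g v c
    simp only [endComp_eq_endArg, h, map_smul, f.map_update_smul]

variable (K V) in
/-- The endomorphism operad of a vector space. -/
def endOperad : NSOperad where
  Op n := MultilinearMap K (fun _ : Fin n => V) V
  unit := LinearMap.id.compMultilinearMap (MultilinearMap.ofSubsingleton K V V 0 LinearMap.id)
  comp i hi hk f g := endCompMultilinear i hi hk f g
  unit_comp hi hk g := MultilinearMap.ext fun v => endComp_unit_left hi hk g v
  comp_unit i hi hk f := MultilinearMap.ext fun v => endComp_unit_right i hi hk f v
  comp_seq i j hi hj hs ht hij hk hk' f g h :=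
    MultilinearMap.ext fun v => endComp_seq i j hi hj hs ht hij hk hk' f g h v
  comp_par i j hle hi hj hs ht hj' hi' hk hk' f g h :=
    MultilinearMap.ext fun v => endComp_par i j hle hi hj hs ht hj' hi' hk hk' f g h v

/-- An operation of the endomorphism operad as a multilinear map. -/
def endOperad.toMultilinearMap {n : ℕ} (f : (endOperad K V).Op n) :
    MultilinearMap K (fun _ : Fin n => V) V := f

theorem endComp_sum {ι κ : Type*} {m n k : ℕ} (i : ℕ) (hi : i < m) (hk : k + 1 = m + n)
    (f : ι → MultilinearMap K (fun _ : Fin m => V) V)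
    (g : κ → MultilinearMap K (fun _ : Fin n => V) V) (a : ι →₀ K) (b : κ →₀ K) (v : Fin k → V) :
    endComp i hi hk (Finsupp.linearCombination K f a) (Finsupp.linearCombination K g b) v =
      a.sum fun p x => b.sum fun q y => (x * y) • endComp i hi hk (f p) (g q) v := by
  have hu : ∀ (f : MultilinearMap K (fun _ : Fin m => V) V) (y : V),
      f (endArg i hi hk y v) = f.toLinearMap (endArg i hi hk 0 v) ⟨i, hi⟩ y := fun f y =>
    congrArg f (endArg_eq_update i hi hk y 0 v)
  simp only [endComp_eq_endArg, Finsupp.linearCombination_apply, Finsupp.sum,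
    sum_apply, smul_apply]
  refine Finset.sum_congr rfl fun p _ => ?_
  simp only [hu, map_sum, map_smul, Finset.smul_sum, mul_smul]

/-- The algebra structure on `V` given by a morphism from a set operad to the endomorphism operad
of `V`. -/
noncomputable def NSOperad.AlgebraOn.ofHom {O : NSOperad} (M : NSOperad.Hom O (endOperad K V)) :
    O.AlgebraOn K V where
  act n := Finsupp.linearCombination K fun x => endOperad.toMultilinearMap (M.map n x)
  act_unit v := by
    rw [Finsupp.linearCombination_single, one_smul, M.map_unit]
    rfl
  act_comp {m n k} i hi hk a b v := by
    have hM : ∀ (p : O.Op m) (q : O.Op n),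
        endOperad.toMultilinearMap (M.map k (O.comp i hi hk p q)) v =
          endComp i hi hk (endOperad.toMultilinearMap (M.map m p))
            (endOperad.toMultilinearMap (M.map n q)) v := fun p q => by
      rw [M.map_comp]
      rfl
    rw [endComp_sum]
    simp only [NSOperad.linComp, Finsupp.sum, map_sum, Finsupp.linearCombination_single,
      sum_apply, smul_apply, hM]

theorem NSOperad.AlgebraOn.ofHom_single {O : NSOperad} (M : NSOperad.Hom O (endOperad K V)) {n : ℕ}
    (x : O.Op n) :
    (ofHom M).act n (Finsupp.single x 1) = endOperad.toMultilinearMap (M.map n x) :=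
  (Finsupp.linearCombination_single K 1 x).trans (one_smul K _)

end Multilinear

/-! ### Algebras and their morphisms, determined on generators -/

namespace NSOperad

theorem linComp_single {K : Type*} [Field K] {O : NSOperad} {m n k : ℕ} (i : ℕ) (hi : i < m)
    (hk : k + 1 = m + n) (p : O.Op m) (q : O.Op n) :
    O.linComp K i hi hk (Finsupp.single p 1) (Finsupp.single q 1) =
      Finsupp.single (O.comp i hi hk p q) 1 := by
  rw [linComp, Finsupp.sum_single_index, Finsupp.sum_single_index, mul_one] <;> simp

namespace AlgebraOn

variable {O : NSOperad} {K : Type*} [Field K] {V W : Type*} [AddCommGroup V] [Module K V]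
  [AddCommGroup W] [Module K W]

theorem act_single_comp (A : O.AlgebraOn K V) {m n k : ℕ} (i : ℕ) (hi : i < m)
    (hk : k + 1 = m + n) (p : O.Op m) (q : O.Op n) (v : Fin k → V) :
    A.act k (Finsupp.single (O.comp i hi hk p q) 1) v =
      endComp i hi hk (A.act m (Finsupp.single p 1)) (A.act n (Finsupp.single q 1)) v := by
  rw [← linComp_single, A.act_comp]

theorem ext_single {A B : O.AlgebraOn K V}
    (h : ∀ (n : ℕ) (x : O.Op n), A.act n (Finsupp.single x 1) = B.act n (Finsupp.single x 1)) :
    A = B := by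
  have : A.act = B.act := funext fun n => Finsupp.lhom_ext' fun x => LinearMap.ext_ring (h n x)
  cases A
  cases B
  congr

theorem act_single_eq_of_generated {A B : O.AlgebraOn K V} {G : ∀ n : ℕ, O.Op n → Prop}
    (h : ∀ (n : ℕ) (x : O.Op n), G n x →
      A.act n (Finsupp.single x 1) = B.act n (Finsupp.single x 1)) {n : ℕ} {x : O.Op n}
    (hx : O.Generated G n x) : A.act n (Finsupp.single x 1) = B.act n (Finsupp.single x 1) := by
  induction hx with
  | unit => exact MultilinearMap.ext fun v => (A.act_unit v).trans (B.act_unit v).symm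
  | gen x hx => exact h _ x hx
  | comp i hi hk p q _ _ ihp ihq =>
    ext v
    rw [act_single_comp, act_single_comp, ihp, ihq]

theorem isHom_of_generated {A : O.AlgebraOn K V} {B : O.AlgebraOn K W} {f : V →ₗ[K] W}
    {G : ∀ n : ℕ, O.Op n → Prop} (hG : ∀ (n : ℕ) (x : O.Op n), O.Generated G n x)
    (h : ∀ (n : ℕ) (x : O.Op n), G n x → ∀ v : Fin n → V,
      f (A.act n (Finsupp.single x 1) v) = B.act n (Finsupp.single x 1) fun j => f (v j)) :
    A.IsHom B f := by
  have key : ∀ (n : ℕ) (x : O.Op n) (v : Fin n → V),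
      f (A.act n (Finsupp.single x 1) v) = B.act n (Finsupp.single x 1) fun j => f (v j) := by
    intro n x
    induction hG n x with
    | unit =>
      intro v
      rw [A.act_unit, B.act_unit]
    | gen x hx => exact h _ x hx
    | comp i hi hk p q _ _ ihp ihq =>
      intro v
      rw [act_single_comp, act_single_comp]
      exact map_endComp i hi hk f ihp ihq v
  intro n a v
  induction a using Finsupp.induction_linear with
  | zero => simp
  | add a b iha ihb => simp only [map_add, add_apply, iha, ihb]
  | single x r =>
    -- Writes `single x r` as `r • single x 1`, so that linearity reduces to basis elements.
    rw [← mul_one r, ← smul_eq_mul, ← Finsupp.smul_single, map_smul, map_smul,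
      smul_apply, smul_apply, map_smul, key]

end AlgebraOn

end NSOperad

/-! ### The bracket identity and the classification of algebras -/

theorem endComp_zero_eq {V : Type*} {m n : ℕ} (hm : 2 ≤ m) (hn : 2 ≤ n)
    (f : (Fin n → V) → V) (g : (Fin m → V) → V) (x : Fin (m + n - 1) → V) :
    endComp 0 (by omega) (by omega) f g x = f (fun j : Fin n =>
      if _h : j.val = 0 then g fun l : Fin m => x ⟨l.val, by omega⟩
      else x ⟨m - 1 + j.val, by omega⟩) := by
  unfold endComp
  congr 1
  funext j
  rw [dif_neg (Nat.not_lt_zero _)]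
  split_ifs
  · congr 1
    funext l
    exact congrArg x (Fin.ext (by simp only; omega))
  · exact congrArg x (Fin.ext (by simp only; omega))

theorem endComp_last_eq {V : Type*} {m n : ℕ} (hm : 2 ≤ m) (hn : 2 ≤ n)
    (f : (Fin m → V) → V) (g : (Fin n → V) → V) (x : Fin (m + n - 1) → V) :
    endComp (m - 1) (by omega) (by omega) f g x = f (fun j : Fin m =>
      if _h : j.val < m - 1 then x ⟨j.val, by omega⟩
      else g fun l : Fin n => x ⟨m - 1 + l.val, by omega⟩) := by
  unfold endComp
  congr 1
  funext j
  split_ifs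
  · rfl
  · rfl
  · omega

theorem bracketIdentity_iff {V : Type*} (br : ∀ n : ℕ, 2 ≤ n → (Fin n → V) → V) :
    BracketIdentity br ↔ ∀ (m n : ℕ) (hm : 2 ≤ m) (hn : 2 ≤ n) (x : Fin (m + n - 1) → V),
      endComp (m - 1) (by omega) (by omega) (br m hm) (br n hn) x =
        endComp 0 (by omega) (by omega) (br n hn) (br m hm) x := by
  refine forall₄_congr fun m n hm hn => forall_congr' fun x => ?_
  rw [endComp_last_eq hm hn, endComp_zero_eq hm hn]

theorem gapNCP.bracketIdentity_act {K : Type*} [Field K] {V : Type*} [AddCommGroup V] [Module K V]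
    (A : gapNCP.AlgebraOn K V) :
    BracketIdentity fun n hn => A.act n (Finsupp.single (gapNCP.p n hn) 1) := by
  rw [bracketIdentity_iff]
  intro m n hm hn x
  rw [← A.act_single_comp, ← A.act_single_comp, gapNCP.comp_p_last]

/-- The inverse of a bijective morphism of operads. -/
noncomputable def NSOperad.Hom.inv {O P : NSOperad} (Θ : Hom O P)
    (h : ∀ n, Function.Bijective (Θ.map n)) : Hom P O where
  map n := (Equiv.ofBijective _ (h n)).symm
  map_unit := (Equiv.symm_apply_eq _).2 Θ.map_unit.symm
  map_comp i hi hk p q := (Equiv.symm_apply_eq _).2 (by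
    change _ = Θ.map _ _
    rw [Θ.map_comp]
    congr 1 <;> exact ((Equiv.ofBijective _ (h _)).apply_symm_apply _).symm)

theorem NSOperad.Hom.inv_map_map {O P : NSOperad} (Θ : Hom O P)
    (h : ∀ n, Function.Bijective (Θ.map n)) {n : ℕ} (x : O.Op n) :
    (Θ.inv h).map n (Θ.map n x) = x :=
  (Equiv.ofBijective _ (h n)).symm_apply_apply x

/-- The composite of two morphisms of operads. -/
def NSOperad.Hom.trans {O P Q : NSOperad} (Θ : Hom O P) (Ψ : Hom P Q) : Hom O Q where
  map n x := Ψ.map n (Θ.map n x)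
  map_unit := by rw [Θ.map_unit, Ψ.map_unit]
  map_comp i hi hk p q := by rw [Θ.map_comp, Ψ.map_comp]

/-- Existence composes the inverse of the isomorphism with the map `Ψ` that the presentation
provides; uniqueness holds because the `p n` generate. -/
theorem gapNCP.existsUnique_algebraOn {K : Type*} [Field K] {V : Type*} [AddCommGroup V]
    [Module K V] (br : ∀ n : ℕ, 2 ≤ n → MultilinearMap K (fun _ : Fin n => V) V)
    (hbr : BracketIdentity fun n hn => br n hn) :
    ∃! A : gapNCP.AlgebraOn K V,
      ∀ (n : ℕ) (hn : 2 ≤ n), A.act n (Finsupp.single (gapNCP.p n hn) 1) = br n hn := by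
  rw [bracketIdentity_iff] at hbr
  let Ψ : NSOperad.Hom Presented (endOperad K V) := lift br (by
    intro m n k hm hn hk
    obtain rfl : k = m + n - 1 := by omega
    exact MultilinearMap.ext (hbr m n hm hn))
  refine ⟨.ofHom ((toGapNCP.inv toGapNCP_bijective).trans Ψ), fun n hn => ?_, fun B hB => ?_⟩
  · rw [NSOperad.AlgebraOn.ofHom_single, ← toGapNCP_q]
    change endOperad.toMultilinearMap (Ψ.map n ((toGapNCP.inv toGapNCP_bijective).map n _)) = _
    rw [NSOperad.Hom.inv_map_map]
    rfl
  · refine NSOperad.AlgebraOn.ext_single fun n x =>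
      NSOperad.AlgebraOn.act_single_eq_of_generated ?_ (generated_p n x)
    rintro n _ ⟨hn, rfl⟩
    rw [hB, NSOperad.AlgebraOn.ofHom_single, ← toGapNCP_q]
    change _ = endOperad.toMultilinearMap (Ψ.map n ((toGapNCP.inv toGapNCP_bijective).map n _))
    rw [NSOperad.Hom.inv_map_map]
    rfl
theorem mainTheorem9 :
    -- the one-block partitions generate the operad
    (∀ (n : ℕ) (x : gapNCP.Op n),
      gapNCP.Generated (fun n y => ∃ hn : 2 ≤ n, y = gapNCP.p n hn) n x) ∧
    -- they satisfy the relations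
    (∀ (m n k : ℕ) (hm : 2 ≤ m) (hn : 2 ≤ n) (hk : k + 1 = m + n),
      gapNCP.comp (m - 1) (by omega) hk (gapNCP.p m hm) (gapNCP.p n hn) =
        gapNCP.comp 0 (by omega) (hk.trans (Nat.add_comm m n))
          (gapNCP.p n hn) (gapNCP.p m hm)) ∧
    -- and these are all the relations: the presented operad is isomorphic to the operad
    (∃ Θ : NSOperad.Hom (NSOperad.presented GapGen GapRel) gapNCP,
      (∀ (n : ℕ) (hn : 2 ≤ n),
        Θ.map n (NSOperad.presented.of (PLift.up hn)) = gapNCP.p n hn) ∧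
      ∀ n : ℕ, Function.Bijective (Θ.map n)) ∧
    -- algebras over the operad: the operations satisfy the identity
    (∀ (K : Type*) [Field K] (V : Type*) [AddCommGroup V] [Module K V]
      (A : gapNCP.AlgebraOn K V),
      BracketIdentity fun n hn => A.act n (Finsupp.single (gapNCP.p n hn) 1)) ∧
    -- every family of multilinear operations with the identity comes from exactly one structure
    (∀ (K : Type*) [Field K] (V : Type*) [AddCommGroup V] [Module K V]
      (br : ∀ n : ℕ, 2 ≤ n → MultilinearMap K (fun _ : Fin n => V) V),
      (BracketIdentity fun n hn => br n hn) →
      ∃! A : gapNCP.AlgebraOn K V,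
        ∀ (n : ℕ) (hn : 2 ≤ n), A.act n (Finsupp.single (gapNCP.p n hn) 1) = br n hn) ∧
    -- and the morphisms of algebras are the linear maps that preserve the operations
    (∀ (K : Type*) [Field K] (V W : Type*) [AddCommGroup V] [Module K V] [AddCommGroup W]
      [Module K W] (A : gapNCP.AlgebraOn K V) (B : gapNCP.AlgebraOn K W) (f : V →ₗ[K] W),
      A.IsHom B f ↔
        ∀ (n : ℕ) (hn : 2 ≤ n) (v : Fin n → V),
          f (A.act n (Finsupp.single (gapNCP.p n hn) 1) v) =
            B.act n (Finsupp.single (gapNCP.p n hn) 1) (fun j => f (v j))) := by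
  refine ⟨gapNCP.generated_p, gapNCP.comp_p_last,
    ⟨gapNCP.toGapNCP, gapNCP.toGapNCP_q, gapNCP.toGapNCP_bijective⟩, ?_, ?_, ?_⟩
  · intro K _ V _ _ A
    exact gapNCP.bracketIdentity_act A
  · intro K _ V _ _ br hbr
    exact gapNCP.existsUnique_algebraOn br hbr
  · intro K _ V W _ _ _ _ A B f
    refine ⟨fun h n hn v => h n _ v, fun h => ?_⟩
    refine NSOperad.AlgebraOn.isHom_of_generated gapNCP.generated_p ?_
    rintro n _ ⟨hn, rfl⟩
    exact h n hn
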